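/- **Proposition 1.** All Hilbert spaces are finite-dimensional, and the systems $A_i$, $B_j$ below have non-zero Hilbert spaces. *No influence.* For a unitary $V:\mathcal H_A\otimes\mathcal H_C\to\mathcal H_B\otimes\mathcal H_D$ write $A\nrightarrow D$ if there is a quantum channel (completely positive trace-preserving map) $\mathcal M:\mathcal L(\mathcal H_C)\to\mathcal L(\mathcal H_D)$ with $\mathrm{Tr}_B[\rho^V_{BD|AC}]=\rho^{\mathcal M}_{D|C}\otimes \mathbb 1_{A^*}$. Here $\rho^{\mathcal C}_{Y|X}=\sum_{i,j}\mathcal C(|i\rangle\langle j|)\otimes|i\rangle_{X^*}\langle j|$ is the Choi–Jamiołkowski operator of a map $\mathcal C:\mathcal L(\mathcal H_X)\to\mathcal L(\mathcal H_Y)$, and $\rho^V$ is that of $\rho\mapsto V\rho V^\dagger$. A *type $(n,k)$ unitary* is a unitary $U:\mathcal H_{A_1}\otimes\dots\otimes\mathcal H_{A_n}\to\mathcal H_{B_1}\otimes\dots\otimes\mathcal H_{B_k}$; for it, $A_i\nrightarrow B_j$ is the above relation with $A=A_i$, $D=B_j$, $C$ all other inputs and $B$ all other outputs. *Diagrams.*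 An *extended circuit diagram* $\mathcal C$ consists of finitely many circles at distinct heights and finitely many wires going upwards. Each wire either is an open incoming wire or starts at a circle, and either is an open outgoing wire or ends at a circle. There are finitely many indices, each with a finite set of values, which may depend on the values of other indices listed before it (nesting). Each wire carries a finite set of indices, containing with an index also those on which its value set depends, and has a Hilbert space for each assignment of values to its indices; open wires carry no index. The Hilbert space of a collection of parallel wires is the direct sum, over all assignments of values to all indices carried by these wires, of the tensor product of the corresponding spaces of the wires. The symbol of a circle has as indices those carried both by some incoming and by some outgoing wire of the circle. Any other index on its incoming (outgoing) wires disappears in (is introduced by) the circle, and such an index may not be carried by a wire passing beside the circle. A circle contains, for each assignment of values to the indices of its symbol, a unitary from the summand of the Hilbert space of its incoming wires with these values to the summand of that of its outgoing wires with these values. The diagram *represents* the map from the tensor product of its open incoming wires to that of its open outgoing wires obtained by composing, from bottom to top, the maps of the circles between consecutive horizontal slices; the map of a circle is the direct sum, over the index values, of its unitaries tensored with the identity on the wires passing beside it. A diagram representing $U$ is *causally faithful* for $U$ if for all $i,j$: there is no directed path in it from $A_i$ to $B_j$ if and only if $A_i\nrightarrow B_j$ in $U$. *Claim.* Let $\mathcal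 C$ be an extended circuit diagram, and let $\mathcal C^\dagger$ be the extended circuit diagram obtained by reading $\mathcal C$ from top to bottom and replacing all unitaries in $\mathcal C$ by their inverses. If $\mathcal C$ represents a type $(n,k)$ unitary $U$, then $\mathcal C^\dagger$ represents the type $(k,n)$ unitary $U^\dagger$. If moreover $\mathcal C$ is causally faithful for $U$, then $\mathcal C^\dagger$ is causally faithful for $U^\dagger$. -/

import Mathlib

open scoped Matrix ComplexOrder

noncomputable section

/-! ### Unitaries, channels and the no-influence relation

A finite-dimensional Hilbert space with a chosen orthonormal basis `X` is `ℂ^X`, a linear map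
between two of them is its matrix, and the tensor product of `ℂ^X` and `ℂ^Y` is `ℂ^(X × Y)`. -/

/-- A (possibly rectangularly indexed) matrix that is a unitary map `ℂ^Y → ℂ^X`. -/
def IsUnitaryMatrix {X Y : Type} [Fintype X] [Fintype Y] [DecidableEq X] [DecidableEq Y]
    (M : Matrix X Y ℂ) : Prop :=
  M * Mᴴ = 1 ∧ Mᴴ * M = 1

theorem IsUnitaryMatrix.conjTranspose {X Y : Type} [Fintype X] [Fintype Y] [DecidableEq X]
    [DecidableEq Y] {M : Matrix X Y ℂ} (h : IsUnitaryMatrix M) : IsUnitaryMatrix Mᴴ :=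
  ⟨by rw [Matrix.conjTranspose_conjTranspose]; exact h.2,
    by rw [Matrix.conjTranspose_conjTranspose]; exact h.1⟩

/-- The map `Φ ⊗ id` on operators on `ℂ^X ⊗ ℂ^R`. -/
def amplify {X Y : Type} (R : Type) (Φ : Matrix X X ℂ →ₗ[ℂ] Matrix Y Y ℂ)
    (Z : Matrix (X × R) (X × R) ℂ) : Matrix (Y × R) (Y × R) ℂ :=
  Matrix.of fun p q => Φ (Matrix.of fun x x' => Z (x, p.2) (x', q.2)) p.1 q.1

/-- A quantum channel: a completely positive and trace-preserving map. -/
structure IsQuantumChannel {X Y : Type} [Fintype X] [Fintype Y]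
    (Φ : Matrix X X ℂ →ₗ[ℂ] Matrix Y Y ℂ) : Prop where
  completelyPositive : ∀ (r : ℕ) (Z : Matrix (X × Fin r) (X × Fin r) ℂ),
    Z.PosSemidef → (amplify (Fin r) Φ Z).PosSemidef
  tracePreserving : ∀ Z : Matrix X X ℂ, (Φ Z).trace = Z.trace

/-- The Choi–Jamiołkowski operator `∑ x x', Φ(|x⟩⟨x'|) ⊗ |x⟩⟨x'|` on `ℂ^Y ⊗ (ℂ^X)^*`, written in
the given basis of `ℂ^Y` and the basis of `(ℂ^X)^*` dual to the given one. -/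
def choi {X Y : Type} [DecidableEq X] (Φ : Matrix X X ℂ →ₗ[ℂ] Matrix Y Y ℂ) :
    Matrix (Y × X) (Y × X) ℂ :=
  Matrix.of fun p q => Φ (Matrix.single p.2 q.2 1) p.1 q.1

/-- The map `ρ ↦ V ρ V†`. -/
def conjugationMap {X Y : Type} [Fintype X] (V : Matrix Y X ℂ) :
    Matrix X X ℂ →ₗ[ℂ] Matrix Y Y ℂ where
  toFun ρ := V * ρ * Vᴴ
  map_add' := by intro a b; rw [Matrix.mul_add, Matrix.add_mul]
  map_smul' := by intro c a; rw [Matrix.mul_smul, Matrix.smul_mul]; rfl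

/-- The no-influence relation `A ↛ D` for `V : ℂ^A ⊗ ℂ^C → ℂ^B ⊗ ℂ^D`: there is a quantum channel
`M` from `C` to `D` with `Tr_B ρ^V_{BD|AC} = ρ^M_{D|C} ⊗ 1_{A^*}`. -/
def NoInfluence {A B C D : Type} [Fintype A] [Fintype B] [Fintype C] [Fintype D]
    [DecidableEq A] [DecidableEq C] (V : Matrix (B × D) (A × C) ℂ) : Prop :=
  ∃ M : Matrix C C ℂ →ₗ[ℂ] Matrix D D ℂ, IsQuantumChannel M ∧
    ∀ (d d' : D) (a a' : A) (c c' : C),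
      ∑ b : B, choi (conjugationMap V) ((b, d), (a, c)) ((b, d'), (a', c')) =
        choi M (d, c) (d', c') * (1 : Matrix A A ℂ) a a'

/-- `⊗ᵢ ℂ^(d i)`, with its product basis, as the tensor product of the factor `i` and the rest. -/
def splitFactor {n : ℕ} (d : Fin n → ℕ) (i : Fin n) :
    (∀ l, Fin (d l)) ≃ Fin (d i) × (∀ l : {l // l ≠ i}, Fin (d l)) :=
  Equiv.piSplitAt i fun l => Fin (d l)

/-- The relation `Aᵢ ↛ Bⱼ` for `U : ⊗ᵢ ℂ^(dA i) → ⊗ⱼ ℂ^(dB j)`. -/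
def DoesNotInfluence {n k : ℕ} {dA : Fin n → ℕ} {dB : Fin k → ℕ}
    (U : Matrix (∀ j, Fin (dB j)) (∀ i, Fin (dA i)) ℂ) (i : Fin n) (j : Fin k) : Prop :=
  NoInfluence (U.reindex ((splitFactor dB j).trans (Equiv.prodComm _ _)) (splitFactor dA i))

/-! ### Extended circuit diagrams -/

/-- The wires, circles and indices of an extended circuit diagram with open incoming wires of
dimensions `dA` and open outgoing wires of dimensions `dB`, without the unitaries in the circles. -/
structure DiagramShape {n k : ℕ} (dA : Fin n → ℕ) (dB : Fin k → ℕ) where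
  numCircles : ℕ
  numWires : ℕ
  numIndices : ℕ
  /-- The position of each circle when the diagram is read from bottom to top. -/
  height : Fin numCircles ≃ Fin numCircles
  /-- The circle a wire comes from; `none` for the open incoming wires. -/
  src : Fin numWires → Option (Fin numCircles)
  /-- The circle a wire goes to; `none` for the open outgoing wires. -/
  tgt : Fin numWires → Option (Fin numCircles)
  upward : ∀ w u v, src w = some u → tgt w = some v → height u < height v
  inWire : Fin n ≃ {w // src w = none}
  outWire : Fin k ≃ {w // tgt w = none}
  /-- Nesting: the indices on which the set of values of an index depends. -/
  dep : Fin numIndices → Finset (Fin numIndices)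
  dep_lt : ∀ j, ∀ i ∈ dep j, i < j
  /-- The index `j` takes the values `0, …, numVals j σ - 1`, given the values `σ` of the indices
  on which it depends. -/
  numVals : ∀ j, ({i // i ∈ dep j} → ℕ) → ℕ
  /-- The tuple of indices carried by a wire. -/
  idx : Fin numWires → Finset (Fin numIndices)
  dep_subset_idx : ∀ w, ∀ j ∈ idx w, dep j ⊆ idx w
  /-- The family of Hilbert spaces of a wire: for the values `σ` of its indices, the space
  `ℂ^(dim w σ)`. -/
  dim : ∀ w, ({i // i ∈ idx w} → ℕ) → ℕ
  idx_in : ∀ w, src w = none → idx w = ∅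
  idx_out : ∀ w, tgt w = none → idx w = ∅
  dim_in : ∀ w (h : src w = none) σ, dim w σ = dA (inWire.symm ⟨w, h⟩)
  dim_out : ∀ w (h : tgt w = none) σ, dim w σ = dB (outWire.symm ⟨w, h⟩)
  /-- The tuple of indices of the symbol in a circle. -/
  symIdx : Fin numCircles → Finset (Fin numIndices)
  /-- The indices of the symbol are those that come in and go out again. The other indices on the
  incoming wires disappear in the circle (it is their sink), and the other indices on the outgoing
  wires are introduced by it (it is their source). -/
  mem_symIdx : ∀ v i, i ∈ symIdx v ↔
    (∃ w, tgt w = some v ∧ i ∈ idx w) ∧ (∃ w, src w = some v ∧ i ∈ idx w)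
  /-- An index that is carried by a wire passing beside a circle neither disappears in that circle
  nor is introduced by it. -/
  loops : ∀ v w i, (∀ u, src w = some u → height u < height v) →
    (∀ u, tgt w = some u → height v < height u) → i ∈ idx w →
    ((∃ w', tgt w' = some v ∧ i ∈ idx w') ↔ (∃ w', src w' = some v ∧ i ∈ idx w'))

namespace DiagramShape

variable {n k : ℕ} {dA : Fin n → ℕ} {dB : Fin k → ℕ} (G : DiagramShape dA dB)

/-- The assignments of values to the indices in `K`. -/
def Assignment (K : Finset (Fin G.numIndices)) : Type :=
  {σ : {i // i ∈ K} → ℕ //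
    ∀ j : {i // i ∈ K}, ∃ h : G.dep j ⊆ K, σ j < G.numVals j fun i => σ ⟨i, h i.2⟩}

/-- The collection of the indices carried by the wires in `S`. -/
def indices (S : Finset (Fin G.numWires)) : Finset (Fin G.numIndices) := S.biUnion G.idx

theorem idx_subset {S : Finset (Fin G.numWires)} {w : Fin G.numWires} (hw : w ∈ S) :
    G.idx w ⊆ G.indices S := Finset.subset_biUnion_of_mem G.idx hw

/-- The Hilbert space of a collection `S` of parallel wires, given by its basis: the direct sum,
over the assignments of values to all the indices carried by wires in `S`, of the tensor product,
over the wires in `S`, of the Hilbert spaces that the wires have for these values. -/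
def Basis (S : Finset (Fin G.numWires)) : Type :=
  Σ σ : G.Assignment (G.indices S),
    ∀ w : {w // w ∈ S}, Fin (G.dim w fun i => σ.1 ⟨i, G.idx_subset w.2 i.2⟩)

/-- The summand of the Hilbert space of `S` in which the indices in `K` have the values `τ`. -/
def Block (S : Finset (Fin G.numWires)) (K : Finset (Fin G.numIndices)) (τ : G.Assignment K) :
    Type :=
  {s : G.Basis S // ∀ i (h : i ∈ G.indices S) (h' : i ∈ K), s.1.1 ⟨i, h⟩ = τ.1 ⟨i, h'⟩}

theorem exists_bound (K : Finset (Fin G.numIndices)) (j : Fin G.numIndices) :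
    ∃ N : ℕ, ∀ (σ : G.Assignment K) (h : j ∈ K), σ.1 ⟨j, h⟩ < N := by
  classical
  induction j using WellFoundedLT.induction with
  | ind j ih =>
    choose! N hN using ih
    obtain ⟨B, hB⟩ := (Set.Finite.image (G.numVals j)
      (Set.Finite.pi' fun i : {i // i ∈ G.dep j} => Set.finite_Iio (N i))).bddAbove
    refine ⟨B + 1, fun σ h => ?_⟩
    obtain ⟨hs, hlt⟩ := σ.2 ⟨j, h⟩
    refine lt_of_lt_of_le hlt (le_trans (hB ⟨_, ?_, rfl⟩) (Nat.le_succ B))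
    intro i
    exact hN i (G.dep_lt j i i.2) σ (hs i.2)

instance (K : Finset (Fin G.numIndices)) : Finite (G.Assignment K) := by
  choose N hN using G.exists_bound K
  exact Finite.of_injective
    (fun (σ : G.Assignment K) (i : {i // i ∈ K}) => (⟨σ.1 i, hN i σ i.2⟩ : Fin (N i)))
    fun σ σ' h => Subtype.ext (funext fun i => congrArg Fin.val (congrFun h i))

instance (K : Finset (Fin G.numIndices)) : Fintype (G.Assignment K) := Fintype.ofFinite _

instance (S : Finset (Fin G.numWires)) : Fintype (G.Basis S) :=
  inferInstanceAs (Fintype (Σ σ : G.Assignment (G.indices S),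
    ∀ w : {w // w ∈ S}, Fin (G.dim w fun i => σ.1 ⟨i, G.idx_subset w.2 i.2⟩)))

instance (S : Finset (Fin G.numWires)) : DecidableEq (G.Basis S) := Classical.decEq _

instance (S : Finset (Fin G.numWires)) (K : Finset (Fin G.numIndices)) (τ : G.Assignment K) :
    Fintype (G.Block S K τ) := by
  classical exact inferInstanceAs (Fintype {s : G.Basis S //
    ∀ i (h : i ∈ G.indices S) (h' : i ∈ K), s.1.1 ⟨i, h⟩ = τ.1 ⟨i, h'⟩})

instance (S : Finset (Fin G.numWires)) (K : Finset (Fin G.numIndices)) (τ : G.Assignment K) :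
    DecidableEq (G.Block S K τ) := Classical.decEq _

/-- The restriction of an assignment. -/
def Assignment.restrict {G : DiagramShape dA dB} {K K' : Finset (Fin G.numIndices)}
    (σ : G.Assignment K) (h : K' ⊆ K) (hK' : ∀ j ∈ K', G.dep j ⊆ K') : G.Assignment K' :=
  ⟨fun i => σ.1 ⟨i, h i.2⟩, fun j => ⟨hK' j j.2, (σ.2 ⟨j, h j.2⟩).2⟩⟩

theorem dep_subset_indices (S : Finset (Fin G.numWires)) :
    ∀ j ∈ G.indices S, G.dep j ⊆ G.indices S := by
  intro j hj
  obtain ⟨w, hw, hjw⟩ := Finset.mem_biUnion.1 hj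
  exact (G.dep_subset_idx w j hjw).trans (G.idx_subset hw)

theorem indices_mono {S S' : Finset (Fin G.numWires)} (h : S' ⊆ S) :
    G.indices S' ⊆ G.indices S := Finset.biUnion_subset_biUnion_of_subset_left _ h

/-- The part of a basis state of the wires in `S` that concerns the wires in `S' ⊆ S`. -/
def Basis.restrict {G : DiagramShape dA dB} {S S' : Finset (Fin G.numWires)}
    (s : G.Basis S) (h : S' ⊆ S) : G.Basis S' :=
  ⟨s.1.restrict (G.indices_mono h) (G.dep_subset_indices S'), fun w => s.2 ⟨w, h w.2⟩⟩

/-- The wires that go into the circle `v`. -/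
def inWires (v : Fin G.numCircles) : Finset (Fin G.numWires) :=
  Finset.univ.filter fun w => G.tgt w = some v

/-- The wires that come out of the circle `v`. -/
def outWires (v : Fin G.numCircles) : Finset (Fin G.numWires) :=
  Finset.univ.filter fun w => G.src w = some v

open Classical in
/-- The wires crossed by the slice that has exactly the `t` lowest circles below it. -/
def slice (t : ℕ) : Finset (Fin G.numWires) :=
  Finset.univ.filter fun w =>
    (∀ u, G.src w = some u → (G.height u : ℕ) < t) ∧ (∀ u, G.tgt w = some u → t ≤ G.height u)

/-- There is a directed path in the diagram from the `i`-th open incoming wire to the `j`-th open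
outgoing wire. -/
def HasPath (i : Fin n) (j : Fin k) : Prop :=
  Relation.ReflTransGen (fun w w' => ∃ v, G.tgt w = some v ∧ G.src w' = some v)
    (G.inWire i).1 (G.outWire j).1

theorem inWires_subset (t : Fin G.numCircles) :
    G.inWires (G.height.symm t) ⊆ G.slice t := by
  intro w hw
  simp only [inWires, slice, Finset.mem_filter, Finset.mem_univ, true_and] at hw ⊢
  refine ⟨fun u hu => ?_, fun u hu => ?_⟩
  · simpa using G.upward w u _ hu hw
  · rw [hw] at hu
    cases hu
    simp

theorem outWires_subset (t : Fin G.numCircles) :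
    G.outWires (G.height.symm t) ⊆ G.slice (t + 1) := by
  intro w hw
  simp only [outWires, slice, Finset.mem_filter, Finset.mem_univ, true_and] at hw ⊢
  refine ⟨fun u hu => ?_, fun u hu => ?_⟩
  · rw [hw] at hu
    cases hu
    simp
  · have := G.upward w _ u hw hu
    simp only [Equiv.apply_symm_apply] at this
    exact this

theorem symIdx_subset_in (v : Fin G.numCircles) : G.symIdx v ⊆ G.indices (G.inWires v) := by
  intro i hi
  obtain ⟨w, hw, hiw⟩ := ((G.mem_symIdx v i).1 hi).1
  exact Finset.mem_biUnion.2 ⟨w, by simpa [inWires] using hw, hiw⟩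

theorem symIdx_subset_out (v : Fin G.numCircles) : G.symIdx v ⊆ G.indices (G.outWires v) := by
  intro i hi
  obtain ⟨w, hw, hiw⟩ := ((G.mem_symIdx v i).1 hi).2
  exact Finset.mem_biUnion.2 ⟨w, by simpa [outWires] using hw, hiw⟩

theorem dep_subset_symIdx (v : Fin G.numCircles) : ∀ j ∈ G.symIdx v, G.dep j ⊆ G.symIdx v := by
  intro j hj i hi
  obtain ⟨⟨w, hw, hjw⟩, ⟨w', hw', hjw'⟩⟩ := (G.mem_symIdx v j).1 hj
  exact (G.mem_symIdx v i).2
    ⟨⟨w, hw, G.dep_subset_idx w j hjw hi⟩, ⟨w', hw', G.dep_subset_idx w' j hjw' hi⟩⟩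

/-- Basis states of two collections of wires agree on all common indices and common wires. -/
def Agree {S' S : Finset (Fin G.numWires)} (s' : G.Basis S') (s : G.Basis S) : Prop :=
  (∀ i (h' : i ∈ G.indices S') (h : i ∈ G.indices S), s'.1.1 ⟨i, h'⟩ = s.1.1 ⟨i, h⟩) ∧
  (∀ w (h' : w ∈ S') (h : w ∈ S), (s'.2 ⟨w, h'⟩ : ℕ) = s.2 ⟨w, h⟩)

theorem src_eq_none {w : Fin G.numWires} (h : w ∈ G.slice 0) : G.src w = none := by
  simp only [slice, Finset.mem_filter, Finset.mem_univ, true_and] at h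
  cases hs : G.src w with
  | none => rfl
  | some u => exact absurd (h.1 u hs) (Nat.not_lt_zero _)

theorem tgt_eq_none {w : Fin G.numWires} (h : w ∈ G.slice G.numCircles) : G.tgt w = none := by
  simp only [slice, Finset.mem_filter, Finset.mem_univ, true_and] at h
  cases hs : G.tgt w with
  | none => rfl
  | some u => exact absurd (h.2 u hs) (Nat.not_le.2 (G.height u).2)

/-- The slice below all circles crosses exactly the open incoming wires: the basis state with the
basis vector `a i` on the `i`-th of them. -/
def inState (a : ∀ i, Fin (dA i)) : G.Basis (G.slice 0) :=
  ⟨⟨fun _ => 0, fun j => by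
      obtain ⟨w, hw, hj⟩ := Finset.mem_biUnion.1 j.2
      rw [G.idx_in w (G.src_eq_none hw)] at hj
      exact absurd hj (Finset.notMem_empty _)⟩,
    fun w => Fin.cast (G.dim_in w (G.src_eq_none w.2) _).symm
      (a (G.inWire.symm ⟨w, G.src_eq_none w.2⟩))⟩

/-- The slice above all circles crosses exactly the open outgoing wires: the basis state with the
basis vector `b j` on the `j`-th of them. -/
def outState (b : ∀ j, Fin (dB j)) : G.Basis (G.slice G.numCircles) :=
  ⟨⟨fun _ => 0, fun j => by
      obtain ⟨w, hw, hj⟩ := Finset.mem_biUnion.1 j.2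
      rw [G.idx_out w (G.tgt_eq_none hw)] at hj
      exact absurd hj (Finset.notMem_empty _)⟩,
    fun w => Fin.cast (G.dim_out w (G.tgt_eq_none w.2) _).symm
      (b (G.outWire.symm ⟨w, G.tgt_eq_none w.2⟩))⟩

/-- The diagram read from top to bottom. -/
@[reducible]
def reverse : DiagramShape dB dA where
  numCircles := G.numCircles
  numWires := G.numWires
  numIndices := G.numIndices
  height := G.height.trans Fin.revPerm
  src := G.tgt
  tgt := G.src
  upward := fun w u v hu hv => by
    simpa using G.upward w v u hv hu
  inWire := G.outWire
  outWire := G.inWire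
  dep := G.dep
  dep_lt := G.dep_lt
  numVals := G.numVals
  idx := G.idx
  dep_subset_idx := G.dep_subset_idx
  dim := G.dim
  idx_in := G.idx_out
  idx_out := G.idx_in
  dim_in := G.dim_out
  dim_out := G.dim_in
  symIdx := G.symIdx
  mem_symIdx := fun v i => (G.mem_symIdx v i).trans and_comm
  loops := fun v w i h₁ h₂ hi =>
    (G.loops v w i (fun u hu => by simpa using h₂ u hu) (fun u hu => by simpa using h₁ u hu)
      hi).symm

end DiagramShape

/-- An extended circuit diagram: in each circle there is, for each assignment of values to the
indices of its symbol, a unitary from the Hilbert space of the incoming wires to the Hilbert space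
of the outgoing wires for these values. -/
structure ExtendedCircuit {n k : ℕ} (dA : Fin n → ℕ) (dB : Fin k → ℕ)
    extends DiagramShape dA dB where
  unitary : ∀ (v : Fin numCircles) (τ : toDiagramShape.Assignment (symIdx v)),
    Matrix (toDiagramShape.Block (toDiagramShape.outWires v) (symIdx v) τ)
      (toDiagramShape.Block (toDiagramShape.inWires v) (symIdx v) τ) ℂ
  isUnitary : ∀ v τ, IsUnitaryMatrix (unitary v τ)

namespace ExtendedCircuit

variable {n k : ℕ} {dA : Fin n → ℕ} {dB : Fin k → ℕ} (C : ExtendedCircuit dA dB)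

open Classical in
/-- The map from the slice just below the circle at height `t` to the slice just above it: the
direct sum, over the values of the indices, of the unitary in the circle tensored with the identity
on the wires that pass beside the circle. -/
def step (t : Fin C.numCircles) :
    Matrix (C.Basis (C.slice (t + 1))) (C.Basis (C.slice t)) ℂ :=
  Matrix.of fun s' s =>
    if h : C.Agree s' s then
      C.unitary (C.height.symm t)
        (s.1.restrict
          ((C.symIdx_subset_in _).trans (C.indices_mono (C.inWires_subset t)))
          (C.dep_subset_symIdx _))
        ⟨s'.restrict (C.outWires_subset t), fun i hi hi' => h.1 i
          (C.indices_mono (C.outWires_subset t) hi)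
          (C.indices_mono (C.inWires_subset t) (C.symIdx_subset_in _ hi'))⟩
        ⟨s.restrict (C.inWires_subset t), fun _ _ _ => rfl⟩
    else 0

/-- The composition of the `t` lowest circles. -/
def evolution : ∀ t : ℕ, t ≤ C.numCircles →
    Matrix (C.Basis (C.slice t)) (C.Basis (C.slice 0)) ℂ
  | 0, _ => 1
  | t + 1, h => C.step ⟨t, h⟩ * evolution t (Nat.le_of_succ_le h)

/-- The diagram represents `U`. -/
def Represents (U : Matrix (∀ j, Fin (dB j)) (∀ i, Fin (dA i)) ℂ) : Prop :=
  ∀ a b, C.evolution C.numCircles le_rfl (C.outState b) (C.inState a) = U b a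

/-- The diagram is causally faithful for `U`. -/
def CausallyFaithful (U : Matrix (∀ j, Fin (dB j)) (∀ i, Fin (dA i)) ℂ) : Prop :=
  C.Represents U ∧ ∀ i j, ¬ C.HasPath i j ↔ DoesNotInfluence U i j

/-- The diagram `C†`: read `C` from top to bottom and replace every unitary by its inverse, which
is its conjugate transpose. -/
@[reducible]
def dagger : ExtendedCircuit dB dA where
  toDiagramShape := C.toDiagramShape.reverse
  unitary := fun (v : Fin C.numCircles) (τ : C.Assignment (C.symIdx v)) => (C.unitary v τ)ᴴ
  isUnitary := fun (v : Fin C.numCircles) (τ : C.Assignment (C.symIdx v)) =>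
    (C.isUnitary v τ).conjTranspose

end ExtendedCircuit

end

open scoped Matrix ComplexOrder

/-! ### The no-influence relation of the adjoint -/

/-! Two independent facts combine. The first is a symmetry of causal influence: `A ↛ D` in a unitary
`V` forces `D ↛ A` in `V†`. In the Heisenberg picture `A ↛ D` says that `V†(1 ⊗ E)V` is trivial on
`A` for every operator `E` on `D`. It therefore commutes with every `Y ⊗ 1`, `Y` acting on `A`.
Conjugating back by `V`, the operator `V(Y ⊗ 1)V†` commutes with all operators on `D`, so it is
trivial on `D`, which is the same condition for `V†` (`NoInfluence.sum_mul_star_eq`,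
`NoInfluence.conjTranspose`). The second is that reversing a diagram reverses its directed paths and
turns each step between slices into its adjoint (`hasPath_reverse`, `step_dagger`). The adjoint of a
product is the product of the adjoints in reverse order, so the reversed diagram represents `U†`. -/

theorem choi_conjugationMap_apply {X Y : Type} [Fintype X] [DecidableEq X] (V : Matrix Y X ℂ)
    (p q : Y × X) : choi (conjugationMap V) p q = V p.1 p.2 * star (V q.1 q.2) := by
  simp [choi, conjugationMap, Matrix.mul_assoc, Matrix.mul_apply, Matrix.single_apply,
    Matrix.conjTranspose_apply, ite_and, Finset.sum_ite_eq]

/-- The completely positive map with Kraus operators `K c`. -/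
noncomputable def krausMap {X Y I : Type} [Fintype X] [Fintype I] (K : I → Matrix Y X ℂ) :
    Matrix X X ℂ →ₗ[ℂ] Matrix Y Y ℂ := ∑ c, conjugationMap (K c)

theorem krausMap_apply {X Y I : Type} [Fintype X] [Fintype I] (K : I → Matrix Y X ℂ)
    (Z : Matrix X X ℂ) : krausMap K Z = ∑ c, K c * Z * (K c)ᴴ := by
  simp [krausMap, conjugationMap]

theorem choi_krausMap_apply {X Y I : Type} [Fintype X] [DecidableEq X] [Fintype I]
    (K : I → Matrix Y X ℂ) (p q : Y × X) :
    choi (krausMap K) p q = ∑ c, K c p.1 p.2 * star (K c q.1 q.2) := by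
  simp_rw [← choi_conjugationMap_apply]
  simp [choi, krausMap, Matrix.sum_apply]

/-- `Φ ⊗ id` again has Kraus form, with operators `K c ⊗ 1`; complete positivity follows because
each summand is a congruence. -/
theorem amplify_krausMap {X Y I R : Type} [Fintype X] [Fintype I] [Fintype R] [DecidableEq R]
    (K : I → Matrix Y X ℂ) (Z : Matrix (X × R) (X × R) ℂ) :
    amplify R (krausMap K) Z =
      ∑ c, Matrix.kroneckerMap (· * ·) (K c) (1 : Matrix R R ℂ) * Z *
        (Matrix.kroneckerMap (· * ·) (K c) (1 : Matrix R R ℂ))ᴴ := by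
  ext ⟨y, r⟩ ⟨y', r'⟩
  simp [amplify, krausMap_apply, Matrix.sum_apply, Matrix.mul_apply, Fintype.sum_prod_type,
    Matrix.one_apply, apply_ite (starRingEnd ℂ)]

theorem isQuantumChannel_krausMap {X Y I : Type} [Fintype X] [DecidableEq X] [Fintype Y]
    [Fintype I] (K : I → Matrix Y X ℂ) (hK : ∑ c, (K c)ᴴ * K c = 1) :
    IsQuantumChannel (krausMap K) where
  completelyPositive r Z hZ := by
    rw [amplify_krausMap]
    exact Matrix.posSemidef_sum _ fun c _ => hZ.mul_mul_conjTranspose_same _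
  tracePreserving Z := by
    rw [krausMap_apply, Matrix.trace_sum]
    have h : ∀ c, (K c * Z * (K c)ᴴ).trace = ((K c)ᴴ * K c * Z).trace := fun c => by
      rw [Matrix.trace_mul_comm, Matrix.mul_assoc]
    rw [Finset.sum_congr rfl fun c _ => h c, ← Matrix.trace_sum, ← Finset.sum_mul, hK,
      Matrix.one_mul]

/-- If `A ↛ D` in the unitary `V`, then `V (Y ⊗ 1) V†` acts trivially on `D` for every operator
`Y` on `A`. -/
theorem NoInfluence.sum_mul_star_eq {A B C D : Type} [Fintype A] [Fintype B] [Fintype C]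
    [Fintype D] [DecidableEq A] [DecidableEq B] [DecidableEq C] [DecidableEq D]
    {V : Matrix (B × D) (A × C) ℂ} (hV : IsUnitaryMatrix V) (h : NoInfluence V)
    (a a' : A) (b b' : B) (d d' d₀ : D) :
    ∑ c, V (b, d) (a, c) * star (V (b', d') (a', c)) =
      if d = d' then ∑ c, V (b, d₀) (a, c) * star (V (b', d₀) (a', c)) else 0 := by
  obtain ⟨M, -, hM⟩ := h
  simp_rw [choi_conjugationMap_apply] at hM
  -- `Y = |a⟩⟨a'| ⊗ 1` on `A ⊗ C`, and `E = 1 ⊗ |d'⟩⟨d₀|` on `B ⊗ D`.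
  let Y : Matrix (A × C) (A × C) ℂ := Matrix.of fun p q => if p.1 = a ∧ q.1 = a' ∧ p.2 = q.2
    then 1 else 0
  let E : Matrix (B × D) (B × D) ℂ := Matrix.of fun p q => if p.2 = d' ∧ q.2 = d₀ ∧ p.1 = q.1
    then 1 else 0
  -- No influence, read in the Heisenberg picture: `V†EV` is the identity on the factor `A`, hence
  -- commutes with `Y`.
  have hG : ∀ p q, (Vᴴ * E * V) p q =
      choi M (d₀, q.2) (d', p.2) * (1 : Matrix A A ℂ) q.1 p.1 := by
    rintro ⟨a₁, c₁⟩ ⟨a₂, c₂⟩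
    rw [← hM]
    simp [E, Matrix.mul_apply, Fintype.sum_prod_type, ite_and, mul_comm]
  have hYG : Vᴴ * E * V * Y = Y * (Vᴴ * E * V) := by
    ext ⟨a₁, c₁⟩ ⟨a₂, c₂⟩
    rw [Matrix.mul_apply, Matrix.mul_apply]
    simp_rw [hG]
    simp only [Y, Matrix.of_apply, Fintype.sum_prod_type, Matrix.one_apply]
    by_cases h₁ : a₁ = a <;> by_cases h₂ : a₂ = a' <;> simp [h₁, h₂, ite_and, Ne.symm, eq_comm]
  have hFE : V * Y * Vᴴ * E = E * (V * Y * Vᴴ) := by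
    calc V * Y * Vᴴ * E = V * Y * Vᴴ * E * (V * Vᴴ) := by rw [hV.1, Matrix.mul_one]
      _ = V * (Y * (Vᴴ * E * V)) * Vᴴ := by simp only [Matrix.mul_assoc]
      _ = (V * Vᴴ) * E * (V * Y * Vᴴ) := by rw [← hYG]; simp only [Matrix.mul_assoc]
      _ = E * (V * Y * Vᴴ) := by rw [hV.1, Matrix.one_mul]
  have hF : ∀ p q, (V * Y * Vᴴ) p q = ∑ c, V p (a, c) * star (V q (a', c)) := by
    intro p q
    simp [Y, Matrix.mul_apply, Fintype.sum_prod_type, ite_and]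
  -- In column `(b', d₀)`, right multiplication by `E` selects the entry with column `(b', d')`,
  -- while left multiplication leaves the entry at `d₀, d₀` if `d = d'` and zero otherwise.
  have := congrFun (congrFun hFE (b, d)) (b', d₀)
  rw [Matrix.mul_apply, Matrix.mul_apply] at this
  simp_rw [hF] at this
  simpa [E, Fintype.sum_prod_type, ite_and] using this

/-- The output on `A` does not depend on the input on `D`, so a channel from `B` to `A` arises by
fixing that input to a basis state `d₀`, applying `V†` and tracing out `C`. This is where `D` must
be non-zero. -/
theorem NoInfluence.conjTranspose {A B C D : Type} [Fintype A] [Fintype B] [Fintype C]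
    [Fintype D] [DecidableEq A] [DecidableEq B] [DecidableEq C] [DecidableEq D] [Nonempty D]
    {V : Matrix (B × D) (A × C) ℂ} (hV : IsUnitaryMatrix V) (h : NoInfluence V) :
    NoInfluence (Vᴴ.reindex (Equiv.prodComm A C) (Equiv.prodComm B D)) := by
  obtain ⟨d₀⟩ := ‹Nonempty D›
  -- The Kraus operators are the blocks `⟨c| V† |d₀⟩`; the sum over `c` is the partial trace over
  -- `C`.
  refine ⟨krausMap fun c => Matrix.of fun a b => star (V (b, d₀) (a, c)),
    isQuantumChannel_krausMap _ ?_, fun a a' d d' b b' => ?_⟩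
  -- Trace preservation is the `(d₀, d₀)` block of `V V† = 1`.
  · ext b b'
    have := congrFun (congrFun hV.1 (b, d₀)) (b', d₀)
    simp only [Matrix.mul_apply, Fintype.sum_prod_type, Matrix.conjTranspose_apply] at this
    simp only [Matrix.sum_apply, Matrix.mul_apply, Matrix.conjTranspose_apply, Matrix.of_apply,
      star_star]
    rw [Finset.sum_comm, this]
    simp [Matrix.one_apply]
  · rw [choi_krausMap_apply]
    simp only [choi_conjugationMap_apply, Matrix.reindex_apply, Matrix.submatrix_apply,
      Equiv.prodComm_symm, Equiv.prodComm_apply, Prod.swap_prod_mk, Matrix.conjTranspose_apply,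
      star_star, Matrix.of_apply]
    have := h.sum_mul_star_eq hV a' a b' b d' d d₀
    simp_rw [mul_comm (star _), this, Matrix.one_apply, eq_comm (a := d')]
    simp

theorem IsUnitaryMatrix.reindex {X Y X' Y' : Type} [Fintype X] [Fintype Y] [DecidableEq X]
    [DecidableEq Y] [Fintype X'] [Fintype Y'] [DecidableEq X'] [DecidableEq Y']
    {M : Matrix X Y ℂ} (h : IsUnitaryMatrix M) (e : X ≃ X') (f : Y ≃ Y') :
    IsUnitaryMatrix (M.reindex e f) := by
  simp [IsUnitaryMatrix, Matrix.conjTranspose_submatrix, Matrix.submatrix_mul_equiv, h.1, h.2]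

theorem DoesNotInfluence.conjTranspose {n k : ℕ} {dA : Fin n → ℕ} {dB : Fin k → ℕ}
    {U : Matrix (∀ j, Fin (dB j)) (∀ i, Fin (dA i)) ℂ} (hU : IsUnitaryMatrix U)
    {i : Fin n} {j : Fin k} (hj : 0 < dB j) (h : DoesNotInfluence U i j) :
    DoesNotInfluence Uᴴ j i := by
  have : Nonempty (Fin (dB j)) := ⟨⟨0, hj⟩⟩
  unfold DoesNotInfluence at h ⊢
  have hV := hU.reindex ((splitFactor dB j).trans (Equiv.prodComm _ _)) (splitFactor dA i)
  have key := NoInfluence.conjTranspose hV h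
  rw [Matrix.conjTranspose_reindex] at key
  exact key

/-! ### The reversed diagram -/

namespace DiagramShape

variable {n k : ℕ} {dA : Fin n → ℕ} {dB : Fin k → ℕ} (G : DiagramShape dA dB)

/-- The `t` lowest circles of the reversed diagram are the `t` highest of the original, so the slice
above them has the other `t'` circles below it in the original. -/
theorem slice_reverse {t t' : ℕ} (h : t + t' = G.numCircles) :
    G.reverse.slice t = G.slice t' := by
  ext w
  simp only [slice, Finset.mem_filter, Finset.mem_univ, true_and, Equiv.trans_apply,
    Fin.revPerm_apply, Fin.val_rev]
  rw [and_comm]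
  refine and_congr (forall_congr' fun u => imp_congr_right fun _ => ?_)
    (forall_congr' fun u => imp_congr_right fun _ => ?_)
  all_goals
    have := (G.height u).isLt
    omega

theorem hasPath_reverse (i : Fin n) (j : Fin k) : G.reverse.HasPath j i ↔ G.HasPath i j := by
  unfold HasPath
  rw [← Relation.reflTransGen_swap]
  have : Function.swap (fun w w' => ∃ v, G.reverse.tgt w = some v ∧ G.reverse.src w' = some v) =
      fun w w' => ∃ v, G.tgt w = some v ∧ G.src w' = some v := by
    funext w w'
    exact propext (exists_congr fun v => and_comm)
  rw [this]

/-- Basis states of a collection of wires, viewed in the reversed and in the original diagram. -/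
def reverseBasisEquiv {S S' : Finset (Fin G.numWires)} (h : S = S') :
    G.reverse.Basis S ≃ G.Basis S' where
  -- Restriction to an equal set of wires serves as the transport, so no casts appear and both round
  -- trips hold by `rfl`.
  toFun s := Basis.restrict (G := G) s h.ge
  invFun s := Basis.restrict (G := G.reverse) s h.le
  left_inv _ := rfl
  right_inv _ := rfl

end DiagramShape

/-! ### Steps and evolution of the reversed diagram -/

namespace ExtendedCircuit

variable {n k : ℕ} {dA : Fin n → ℕ} {dB : Fin k → ℕ} (C : ExtendedCircuit dA dB)

/-- The index types of the matrix depend on `τ`; comparing only the underlying basis states avoids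
heterogeneous equality. -/
theorem unitary_congr (v : Fin C.numCircles) {τ τ' : C.Assignment (C.symIdx v)} (h : τ = τ')
    {x : C.Block (C.outWires v) (C.symIdx v) τ} {x' : C.Block (C.outWires v) (C.symIdx v) τ'}
    {y : C.Block (C.inWires v) (C.symIdx v) τ} {y' : C.Block (C.inWires v) (C.symIdx v) τ'}
    (hx : x.1 = x'.1) (hy : y.1 = y'.1) : C.unitary v τ x y = C.unitary v τ' x' y' := by
  subst h
  rw [Subtype.ext hx, Subtype.ext hy]

theorem step_dagger (t : Fin C.numCircles)
    (h : C.dagger.slice (t + 1) = C.slice t.rev) (h' : C.dagger.slice t = C.slice (t.rev + 1)) :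
    C.dagger.step t =
      (C.step t.rev)ᴴ.submatrix (C.reverseBasisEquiv h) (C.reverseBasisEquiv h') := by
  ext s' s
  rw [Matrix.submatrix_apply, Matrix.conjTranspose_apply]
  unfold step
  rw [Matrix.of_apply, Matrix.of_apply]
  by_cases hs : C.dagger.Agree s' s
  · have hs' : C.Agree (C.reverseBasisEquiv h' s) (C.reverseBasisEquiv h s') :=
      ⟨fun i _ _ => (hs.1 i _ _).symm, fun w _ _ => (hs.2 w _ _).symm⟩
    rw [dif_pos hs, dif_pos hs']
    refine congrArg star (C.unitary_congr _ ?_ rfl rfl)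
    -- Each diagram reads the symbol's values off the wires entering the circle, which lie on
    -- opposite sides of it in the two diagrams; `Agree` identifies the two readings.
    exact Subtype.ext (funext fun i => (hs.1 i _ _).symm)
  · have hs' : ¬ C.Agree (C.reverseBasisEquiv h' s) (C.reverseBasisEquiv h s') := fun hs' =>
      hs ⟨fun i hi hi' => (hs'.1 i (h' ▸ hi') (h ▸ hi)).symm,
        fun w hw hw' => (hs'.2 w (h' ▸ hw') (h ▸ hw)).symm⟩
    rw [dif_neg hs, dif_neg hs', star_zero]

/-- `evolution` composes only from the bottom, so the product of the upper `t` circles is expressed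
as the adjoint of the reversed evolution. Induction on `t` moves one circle at a time across the
product: `(S†D)† E = D† (S E)`. -/
theorem evolution_dagger_conjTranspose_mul (t t' : ℕ) (ht : t ≤ C.numCircles)
    (ht' : t' ≤ C.numCircles) (h : C.dagger.slice t = C.slice t')
    (h₀ : C.dagger.slice 0 = C.slice C.numCircles) (htt' : t + t' = C.numCircles) :
    ((C.dagger.evolution t ht).submatrix (C.reverseBasisEquiv h).symm
      (C.reverseBasisEquiv h₀).symm)ᴴ *
      C.evolution t' ht' = C.evolution C.numCircles le_rfl := by
  induction t generalizing t' with
  | zero =>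
    obtain rfl : t' = C.numCircles := by omega
    have : (C.dagger.evolution 0 ht).submatrix (C.reverseBasisEquiv h).symm
        (C.reverseBasisEquiv h₀).symm = 1 :=
      Matrix.submatrix_one_equiv (C.reverseBasisEquiv h).symm
    rw [this, Matrix.conjTranspose_one, Matrix.one_mul]
  | succ t ih =>
    have hh : C.dagger.slice t = C.slice (t' + 1) :=
      C.toDiagramShape.slice_reverse (by omega)
    rw [← ih (t' + 1) (by omega) (by omega) hh (by omega)]
    -- Substituting `Fin.rev` for `t'` makes the slices in the types match those of `step_dagger`.
    have hr : t' = (Fin.rev ⟨t, ht⟩ : Fin C.numCircles) := by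
      simp only [Fin.val_rev]; omega
    subst hr
    have hstep := C.step_dagger ⟨t, ht⟩ h hh
    have hevo : C.dagger.evolution (t + 1) ht =
        C.dagger.step ⟨t, ht⟩ * C.dagger.evolution t (Nat.le_of_succ_le ht) := rfl
    have hevo' : ∀ r : Fin C.numCircles, C.evolution (r + 1) r.2 =
        C.step r * C.evolution r r.2.le := fun _ => rfl
    rw [hevo', hevo, hstep, ← Matrix.submatrix_mul_equiv _ _ _ (C.reverseBasisEquiv hh).symm,
      Matrix.conjTranspose_mul, ← Matrix.mul_assoc]
    simp [Matrix.conjTranspose_submatrix]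

theorem Represents.dagger {C : ExtendedCircuit dA dB}
    {U : Matrix (∀ j, Fin (dB j)) (∀ i, Fin (dA i)) ℂ} (hC : C.Represents U) :
    C.dagger.Represents Uᴴ := by
  intro b a
  have h : C.dagger.slice C.numCircles = C.slice 0 := C.toDiagramShape.slice_reverse rfl
  have h₀ : C.dagger.slice 0 = C.slice C.numCircles :=
    C.toDiagramShape.slice_reverse (Nat.zero_add _)
  have key := C.evolution_dagger_conjTranspose_mul C.numCircles 0 le_rfl (Nat.zero_le _) h h₀ rfl
  have h1 : C.evolution 0 (Nat.zero_le _) = 1 := rfl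
  rw [h1, Matrix.mul_one] at key
  rw [Matrix.conjTranspose_apply, ← hC a b, ← key, Matrix.conjTranspose_apply, star_star]
  -- The open-wire states of the reversed diagram are, by definition, the transported ones of the
  -- original with the two ends exchanged.
  rfl

theorem CausallyFaithful.dagger {C : ExtendedCircuit dA dB}
    {U : Matrix (∀ j, Fin (dB j)) (∀ i, Fin (dA i)) ℂ} (hA : ∀ i, 0 < dA i) (hB : ∀ j, 0 < dB j)
    (hU : IsUnitaryMatrix U) (hC : C.CausallyFaithful U) : C.dagger.CausallyFaithful Uᴴ := by
  refine ⟨hC.1.dagger, fun j i => ?_⟩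
  rw [C.toDiagramShape.hasPath_reverse i j, hC.2 i j]
  refine ⟨fun h => h.conjTranspose hU (hB j), fun h => ?_⟩
  -- The converse is the same implication for `U†`, with `U†† = U`; the fixed input state now lives
  -- on `A i`.
  simpa using h.conjTranspose hU.conjTranspose (hA i)

end ExtendedCircuit

theorem proposition1 {n k : ℕ} {dA : Fin n → ℕ} {dB : Fin k → ℕ}
    (hA : ∀ i, 0 < dA i) (hB : ∀ j, 0 < dB j)
    (C : ExtendedCircuit dA dB)
    (U : Matrix (∀ j, Fin (dB j)) (∀ i, Fin (dA i)) ℂ) (hU : IsUnitaryMatrix U)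
    (hC : C.Represents U) :
    IsUnitaryMatrix Uᴴ ∧ C.dagger.Represents Uᴴ ∧
      (C.CausallyFaithful U → C.dagger.CausallyFaithful Uᴴ) :=
  ⟨hU.conjTranspose, hC.dagger, fun h => h.dagger hA hB hU⟩
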